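/- For every $\kappa\in\mathbb{R}$ there exist constants $\tau>0$, $c>0$ and $n_0\in\mathbb{N}$, depending only on $\kappa$, such that the following holds for all integers $n\ge \max(n_0,1)$ and all integers $m\ge 0$. Let $\boldsymbol{Y}$ be uniformly distributed over $\{0,1\}^m$ and let $\boldsymbol{X}=f(\boldsymbol{Y})$ for a function $f\colon\{0,1\}^m\to\{0,1\}^n$. Suppose that every output bit $f_i$, $i\in\{1,\dots,n\}$, is computed by a DNF formula in the $m$ input bits (a disjunction of terms, each of which is a conjunction of literals $y_j$ or $\neg y_j$) of size (number of terms) at most $s$ and width (maximum number of literals in a term) at most $d$, where $d,s$ are nonnegative integers with $$d\le \frac{\tau\log n}{\log\log n}\qquad\text{and}\qquad s\le \kappa n^{\kappa}.$$ Then $$\Delta(\boldsymbol{X},\boldsymbol{U}_1^n)\ \ge\ 1-n^{-c}.$$ Here $\boldsymbol{U}_1^n$ is the uniform distribution over the $n$ strings in $\{0,1\}^n$ with exactly one bit equal to $1$, and $\Delta(P,Q)=\max_{A}|P(A)-Q(A)|$ (maximum over all $A\subseteq\{0,1\}^n$) is the statistical distance. -/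

import Mathlib

/-- A literal over `m` Boolean variables: `(j, b)` is satisfied by `y` iff `y j = b`. -/
abbrev BoolLiteral (m : ℕ) : Type := Fin m × Bool

/-- A term: a conjunction of literals. The empty term is identically true. -/
abbrev DNFTerm (m : ℕ) : Type := Finset (BoolLiteral m)

/-- The value of a term: all of its literals are satisfied. -/
def DNFTerm.eval {m : ℕ} (T : DNFTerm m) (y : Fin m → Bool) : Bool :=
  decide (∀ l ∈ T, y l.1 = l.2)

/-- A DNF formula: a disjunction of terms. The empty DNF is identically false. -/
abbrev DNF (m : ℕ) : Type := Finset (DNFTerm m)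

/-- The value of a DNF: some term is satisfied. -/
def DNF.eval {m : ℕ} (φ : DNF m) (y : Fin m → Bool) : Bool :=
  decide (∃ T ∈ φ, DNFTerm.eval T y = true)

/-- The size of a DNF: its number of terms. -/
def DNF.size {m : ℕ} (φ : DNF m) : ℕ := φ.card

/-- The width of a DNF: the largest number of literals in a term. -/
def DNF.width {m : ℕ} (φ : DNF m) : ℕ := φ.sup Finset.card

/-- The Hamming weight of a bit string. -/
def hammingWeight {n : ℕ} (x : Fin n → Bool) : ℕ := (Finset.univ.filter fun i => x i = true).card

/-- The `k`-slice: the `n`-bit strings of Hamming weight `k`. -/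
def boolSlice (n k : ℕ) : Finset (Fin n → Bool) :=
  Finset.univ.filter fun x => hammingWeight x = k

theorem boolSlice_nonempty {n k : ℕ} (h : k ≤ n) : (boolSlice n k).Nonempty := by
  obtain ⟨S, -, hS⟩ := Finset.exists_subset_card_eq (s := (Finset.univ : Finset (Fin n)))
    (by simpa using h)
  exact ⟨fun i => decide (i ∈ S), by
    rw [boolSlice, Finset.mem_filter]
    simp [hammingWeight, hS]⟩

/-- The uniform distribution over the `k`-slice of the `n`-cube. -/
noncomputable def uniformSlice (n k : ℕ) (h : k ≤ n) : PMF (Fin n → Bool) :=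
  PMF.uniformOfFinset (boolSlice n k) (boolSlice_nonempty h)

/-- The distribution of `f Y` for `Y` uniform over `{0,1}^m`. -/
noncomputable def sourceDist {m n : ℕ} (f : (Fin m → Bool) → (Fin n → Bool)) :
    PMF (Fin n → Bool) :=
  (PMF.uniformOfFintype (Fin m → Bool)).map f

/-- Statistical distance: the largest difference of the probabilities of an event. -/
noncomputable def statDist {α : Type*} (P Q : PMF α) : ℝ :=
  ⨆ A : Set α, |(P.toOuterMeasure A).toReal - (Q.toOuterMeasure A).toReal|

/-!
Let `T i` be terms of width at most `d`, one for each of many output bits `i`. By a robust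
sunflower lemma (`exists_kernel`) some `T i` contains a subterm `K`, a *kernel*, such that when `K`
is satisfied, at least two of the terms are satisfied, and so at least two output bits are `1`,
except with probability `2 ^ (-L)`. Hence the set `S` of output bits having a satisfiable term
without a kernel inside is small. If the output has weight one with its `1` at a position outside
`S`, then some term of the circuit is satisfied, so its kernel is satisfied while at most one
output bit is `1`; a union bound over the at most `n * s` terms shows that this is unlikely
(`exists_small_card_and_card_eval_le`). The uniform distribution on the weight one strings, on the
other hand, puts its `1` outside `S` with probability `1 - #S / n`.

For the robust sunflower lemma, fix an assignment `z` satisfying many of the terms, so that only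
the sets of variables of these terms matter. Choosing the variables `K` of the kernel to maximize
`#{i | K ⊆ V i} * M ^ #K` makes the family of petals `V i \ K` spread. For a spread family the
second moment method (`card_agree_le_one_le_half`) shows that inside one of `L` random blocks of
coordinates at least two petals are satisfied with probability at least `1 / 2`, and independence
of the blocks improves the failure probability to `2 ^ (-L)` (`card_agree_le_one_le_two_pow`).
The lemma needs about `(L ^ 2 * d) ^ d` terms; with `L` of order `log n` this is at most a small
power of `n` exactly because `d` is at most a small multiple of `log n / log log n`.
-/

/-! ### Counting assignments -/

open Finset in
theorem card_filter_agree_mul_pow {ι A : Type*} [Fintype ι] [DecidableEq ι] [Fintype A]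
    [DecidableEq A] (P : Finset ι) (a : ι → A) :
    #{ω : ι → A | ∀ j ∈ P, ω j = a j} * Fintype.card A ^ #P
      = Fintype.card A ^ Fintype.card ι := by
  have h : ({ω : ι → A | ∀ j ∈ P, ω j = a j} : Finset (ι → A))
      = Fintype.piFinset fun j => if j ∈ P then {a j} else univ := by
    ext ω
    simp only [mem_filter, mem_univ, true_and, Fintype.mem_piFinset]
    refine forall_congr' fun j => ?_
    by_cases hj : j ∈ P <;> simp [hj]
  have h2 : ∀ j, #(if j ∈ P then ({a j} : Finset A) else univ)
      = if j ∈ P then 1 else Fintype.card A := by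
    intro j; split_ifs <;> simp
  rw [h, Fintype.card_piFinset]
  simp_rw [h2]
  rw [Finset.prod_ite]
  simp only [prod_const, one_pow, one_mul]
  rw [← pow_add, ← Finset.card_univ (α := ι),
    ← Finset.card_filter_add_card_filter_not (s := univ) (fun j => j ∈ P), add_comm]
  congr 2
  simp

open Finset in
/-- The fibers of `χ` partition the coordinates, so an assignment is a free choice of one assignment
per fiber. -/
theorem card_filter_forall_fiber {ι B : Type*} [Fintype ι] [DecidableEq ι] [Fintype B]
    [DecidableEq B] (χ : ι → B) (S : ∀ b, Finset ({j // χ j = b} → Bool)) :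
    #{y : ι → Bool | ∀ b, (fun j : {j // χ j = b} => y j) ∈ S b} = ∏ b, #(S b) := by
  rw [← Fintype.card_piFinset]
  refine Finset.card_bij (fun y _ b j => y j) ?_ ?_ ?_
  · intro y hy
    simpa using hy
  · intro y _ y' _ h
    funext j
    exact congrFun (congrFun h (χ j)) ⟨j, rfl⟩
  · intro u hu
    have key : ∀ b, (fun j : {j // χ j = b} => u (χ j) ⟨j, rfl⟩) = u b := by
      intro b; funext ⟨j, hj⟩; subst hj; rfl
    refine ⟨fun j => u (χ j) ⟨j, rfl⟩, ?_, funext key⟩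
    simp only [mem_filter, mem_univ, true_and, key]
    simpa using hu

open Finset in
/-- Events that depend on disjoint sets of coordinates are independent. -/
theorem density_forall_fiber {ι B : Type*} [Fintype ι] [DecidableEq ι] [Fintype B]
    [DecidableEq B] (χ : ι → B) (E : B → (ι → Bool) → Prop) [∀ b, DecidablePred (E b)]
    (hE : ∀ b y y', (∀ j, χ j = b → y j = y' j) → E b y → E b y') :
    (#{y | ∀ b, E b y} : ℝ) / 2 ^ Fintype.card ι
      = ∏ b, (#{y | E b y} : ℝ) / 2 ^ Fintype.card ι := by
  classical
  set S : ∀ b, Finset ({j // χ j = b} → Bool) := fun b =>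
    univ.filter fun u => ∃ y, E b y ∧ (fun j : {j // χ j = b} => y j) = u with hS
  have hmem : ∀ b y, (fun j : {j // χ j = b} => y j) ∈ S b ↔ E b y := by
    intro b y
    simp only [hS, mem_filter, mem_univ, true_and]
    refine ⟨fun ⟨y', hy', h⟩ => hE b y' y (fun j hj => congrFun h ⟨j, hj⟩) hy',
      fun h => ⟨y, h, rfl⟩⟩
  have hall : #{y | ∀ b, E b y} = ∏ b, #(S b) := by
    rw [← card_filter_forall_fiber]
    simp_rw [hmem]
  have htot : (2 : ℝ) ^ Fintype.card ι = ∏ b, (2 : ℝ) ^ Fintype.card {j // χ j = b} := by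
    have := card_filter_forall_fiber χ (fun b => univ)
    simp only [mem_univ, implies_true, filter_true, Finset.card_univ, Fintype.card_pi,
      Fintype.card_bool, prod_const] at this
    exact_mod_cast this
  have hone : ∀ b, (#{y | E b y} : ℝ) / 2 ^ Fintype.card ι
      = (#(S b) : ℝ) / 2 ^ Fintype.card {j // χ j = b} := by
    intro b
    have h1 : #{y | E b y} = ∏ b', #(if b' = b then S b' else univ) := by
      rw [← card_filter_forall_fiber]
      congr 1
      ext y
      simp only [mem_filter, mem_univ, true_and]
      constructor
      · intro h b'
        split_ifs with hb
        · subst hb; exact (hmem _ _).2 h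
        · exact mem_univ _
      · intro h
        have := h b
        rw [if_pos rfl] at this
        exact (hmem _ _).1 this
    rw [h1, htot]
    push_cast
    rw [← prod_div_distrib, prod_eq_single b]
    · rw [if_pos rfl]
    · intro b' _ hb'
      rw [if_neg hb']
      simp
    · simp
  rw [hall, htot]
  push_cast
  rw [← prod_div_distrib]
  exact prod_congr rfl fun b _ => by rw [← htot, hone]

/-! ### Spread families of sets -/

open Finset in
/-- The condition `hspread` says that no set `J` lies in more than a fraction `M ^ (-#J)` of the
sets `P i`; it bounds the correlations of one set with the whole family. -/
theorem sum_pow_card_inter_le {ι I : Type*} [DecidableEq ι] {F : Finset I} {P : I → Finset ι}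
    {d : ℕ} {M q : ℝ} (hM : 0 < M) (hq : 0 ≤ q)
    (hspread : ∀ J : Finset ι, (#{i ∈ F | J ⊆ P i} : ℝ) * M ^ #J ≤ #F)
    (Q : Finset ι) (hQ : #Q ≤ d) :
    ∑ i ∈ F, q ^ #(Q ∩ P i) ≤ #F * (1 + q / M) ^ d := by
  have hqM : 0 ≤ q / M := div_nonneg hq hM.le
  calc ∑ i ∈ F, q ^ #(Q ∩ P i)
      ≤ ∑ i ∈ F, ∑ J ∈ Q.powerset, if J ⊆ P i then q ^ #J else 0 := by
        refine sum_le_sum fun i _ => ?_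
        have h1 : Q.powerset.filter (fun J => J ⊆ P i) = (Q ∩ P i).powerset := by
          ext J; simp only [mem_filter, mem_powerset, subset_inter_iff]
        rw [← sum_filter, h1]
        exact single_le_sum (f := fun J => q ^ #J) (fun J _ => pow_nonneg hq _)
          (mem_powerset_self _)
    _ = ∑ J ∈ Q.powerset, #{i ∈ F | J ⊆ P i} * q ^ #J := by
        rw [sum_comm]
        refine sum_congr rfl fun J _ => ?_
        rw [← sum_filter, sum_const, nsmul_eq_mul]
    _ ≤ ∑ J ∈ Q.powerset, #F * (q / M) ^ #J := by
        refine sum_le_sum fun J _ => ?_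
        have := hspread J
        have hMJ : 0 < M ^ #J := pow_pos hM _
        rw [div_pow, mul_div_assoc', le_div_iff₀ hMJ]
        nlinarith [pow_nonneg hq #J, mul_le_mul_of_nonneg_right this (pow_nonneg hq #J)]
    _ = #F * (1 + q / M) ^ #Q := by
        rw [← mul_sum, add_comm, ← Finset.sum_pow_mul_eq_add_pow]
        simp
    _ ≤ #F * (1 + q / M) ^ d := by
        gcongr
        linarith

open Finset in
/-- The second moment method. A uniformly random `ω` agrees with `a` on at least two of the sets
`P i` with probability at least `1 / 2` when the family `P` is spread. -/
theorem card_agree_le_one_le_half {ι A I : Type*} [Fintype ι] [DecidableEq ι] [Fintype A]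
    [DecidableEq A] [Nonempty A] (a : ι → A) {F : Finset I} {P : I → Finset ι} {d : ℕ} {M : ℝ}
    (hP : ∀ i ∈ F, #(P i) ≤ d)
    (hM : 16 * (Fintype.card A : ℝ) * (d + 1) ≤ M)
    (hF : 2 * (Fintype.card A : ℝ) ^ d ≤ #F)
    (hspread : ∀ J : Finset ι, (#{i ∈ F | J ⊆ P i} : ℝ) * M ^ #J ≤ #F) :
    (#{ω : ι → A | #{i ∈ F | ∀ j ∈ P i, ω j = a j} ≤ 1} : ℝ)
      ≤ (Fintype.card A : ℝ) ^ Fintype.card ι / 2 := by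
  classical
  set q : ℝ := (Fintype.card A : ℝ) with hqdef
  have hq1 : 1 ≤ q := by
    rw [hqdef]
    exact_mod_cast Fintype.card_pos (α := A)
  have hq : 0 < q := by linarith
  set T : ℝ := q ^ Fintype.card ι with hT
  have hTpos : 0 < T := pow_pos hq _
  have hMpos : 0 < M := by
    have : 0 < 16 * q * (d + 1) := by positivity
    linarith
  have hFpos : 0 < (#F : ℝ) := by
    have : 0 < 2 * q ^ d := by positivity
    linarith
  -- Weighting each set by the inverse of its probability makes every term have mean `1`.
  set X : (ι → A) → ℝ := fun ω =>
    ∑ i ∈ F, if ∀ j ∈ P i, ω j = a j then q ^ #(P i) else 0 with hX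
  have hcard : ∀ Q : Finset ι, (#{ω : ι → A | ∀ j ∈ Q, ω j = a j} : ℝ) * q ^ #Q = T := by
    intro Q
    rw [hT, hqdef]
    exact_mod_cast card_filter_agree_mul_pow Q a
  have hmean : ∑ ω, X ω = #F * T := by
    rw [hX, sum_comm, ← nsmul_eq_mul, ← sum_const]
    refine sum_congr rfl fun i _ => ?_
    rw [← sum_filter, sum_const, nsmul_eq_mul, hcard]
  have hsq : ∑ ω, X ω ^ 2 = T * ∑ i ∈ F, ∑ i' ∈ F, q ^ #(P i ∩ P i') := by
    simp_rw [hX, sq, sum_mul_sum]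
    rw [sum_comm, mul_sum]
    refine sum_congr rfl fun i _ => ?_
    rw [sum_comm, mul_sum]
    refine sum_congr rfl fun i' _ => ?_
    have h1 : ∀ ω : ι → A, ((if ∀ j ∈ P i, ω j = a j then q ^ #(P i) else 0) *
        (if ∀ j ∈ P i', ω j = a j then q ^ #(P i') else 0))
        = if ∀ j ∈ P i ∪ P i', ω j = a j then q ^ #(P i) * q ^ #(P i') else 0 := by
      intro ω
      simp only [mem_union, or_imp, forall_and]
      split_ifs <;> simp_all
    simp_rw [h1]
    rw [← sum_filter, sum_const, nsmul_eq_mul, ← pow_add, ← card_union_add_card_inter, pow_add,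
      ← mul_assoc, hcard]
  have hinner : ∀ i ∈ F, ∑ i' ∈ F, q ^ #(P i ∩ P i') ≤ #F * (1 + q / M) ^ d := fun i hi =>
    sum_pow_card_inter_le hMpos hq.le hspread (P i) (hP i hi)
  have hpow : (1 + q / M) ^ d ≤ 1 + 1 / 8 := by
    have hx : d * (q / M) ≤ 1 / 16 := by
      rw [mul_div_assoc', div_le_iff₀ hMpos]
      nlinarith
    have hx0 : 0 ≤ d * (q / M) := by positivity
    calc (1 + q / M) ^ d ≤ Real.exp (q / M) ^ d := by
          gcongr
          linarith [Real.add_one_le_exp (q / M)]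
      _ = Real.exp (d * (q / M)) := (Real.exp_nat_mul _ _).symm
      _ ≤ 1 + 1 / 8 := by
          have h := Real.abs_exp_sub_one_le (x := d * (q / M))
            (by rw [abs_of_nonneg hx0]; linarith)
          rw [abs_of_nonneg hx0] at h
          linarith [le_abs_self (Real.exp (d * (q / M)) - 1)]
  have hsq_le : ∑ ω, X ω ^ 2 ≤ T * (#F * (#F * (1 + 1 / 8))) := by
    rw [hsq]
    gcongr
    calc _ ≤ ∑ i ∈ F, (#F : ℝ) * (1 + 1 / 8) := by
          refine sum_le_sum fun i hi => (hinner i hi).trans ?_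
          gcongr
      _ = _ := by rw [sum_const, nsmul_eq_mul]
  have hvar : ∑ ω, (X ω - #F) ^ 2 ≤ T * #F ^ 2 / 8 := by
    have hc : ∑ ω : ι → A, (#F : ℝ) ^ 2 = T * #F ^ 2 := by
      rw [sum_const, nsmul_eq_mul, Finset.card_univ, Fintype.card_fun]
      push_cast
      rfl
    have hexp : ∑ ω, (X ω - #F) ^ 2
        = ∑ ω, X ω ^ 2 - 2 * #F * ∑ ω, X ω + ∑ ω : ι → A, (#F : ℝ) ^ 2 := by
      rw [mul_sum, ← sum_sub_distrib, ← sum_add_distrib]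
      exact sum_congr rfl fun ω _ => by ring
    rw [hexp, hc, hmean]
    nlinarith
  -- With at most one agreement the weighted count is at most `q ^ d`, half of its mean.
  have hbad : ∀ ω : ι → A, #{i ∈ F | ∀ j ∈ P i, ω j = a j} ≤ 1 →
      (#F : ℝ) ^ 2 / 4 ≤ (X ω - #F) ^ 2 := by
    intro ω hω
    have hXle : X ω ≤ q ^ d := by
      rw [hX]
      simp only
      rw [← sum_filter]
      calc _ ≤ ∑ i ∈ F with ∀ j ∈ P i, ω j = a j, q ^ d := by
            refine sum_le_sum fun i hi => pow_le_pow_right₀ hq1 (hP i (mem_filter.1 hi).1)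
        _ = #{i ∈ F | ∀ j ∈ P i, ω j = a j} * q ^ d := by rw [sum_const, nsmul_eq_mul]
        _ ≤ 1 * q ^ d := by
            gcongr
            exact_mod_cast hω
        _ = q ^ d := one_mul _
    nlinarith
  have hmarkov : (#{ω : ι → A | #{i ∈ F | ∀ j ∈ P i, ω j = a j} ≤ 1} : ℝ) * (#F ^ 2 / 4)
      ≤ T * #F ^ 2 / 8 := by
    rw [← nsmul_eq_mul, ← sum_const]
    refine le_trans ?_ hvar
    refine (sum_le_sum fun ω hω => hbad ω (mem_filter.1 hω).2).trans ?_
    exact sum_le_sum_of_subset_of_nonneg (filter_subset _ _) fun _ _ _ => sq_nonneg _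
  have hF2 : 0 < (#F : ℝ) ^ 2 := by positivity
  nlinarith

open Finset in
/-- A random partition of the coordinates into `L` blocks amplifies the second moment bound:
some partition has average failure probability at most `1 / 2` per block, and the blocks are
independent. -/
theorem card_agree_le_one_le_two_pow {m d L : ℕ} {I : Type*} (hL : 1 ≤ L) (z : Fin m → Bool)
    {F : Finset I} {P : I → Finset (Fin m)} {M : ℝ}
    (hP : ∀ i ∈ F, #(P i) ≤ d)
    (hM : 32 * (L : ℝ) * (d + 1) ≤ M)
    (hF : 2 * (2 * L : ℝ) ^ d ≤ #F)
    (hspread : ∀ J : Finset (Fin m), (#{i ∈ F | J ⊆ P i} : ℝ) * M ^ #J ≤ #F) :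
    (#{y : Fin m → Bool | #{i ∈ F | ∀ j ∈ P i, y j = z j} ≤ 1} : ℝ) ≤ 2 ^ m / 2 ^ L := by
  classical
  have : Nonempty (Fin L) := ⟨⟨0, hL⟩⟩
  have hq : (Fintype.card (Fin L × Bool) : ℝ) = 2 * L := by
    simp [mul_comm]
  -- `E χ b y`: at most one of the sets lies in block `b` and is agreed upon by `y`.
  set E : (Fin m → Fin L) → Fin L → (Fin m → Bool) → Prop := fun χ b y =>
    #{i ∈ F | ∀ j ∈ P i, χ j = b ∧ y j = z j} ≤ 1 with hE
  have hblock : ∀ b : Fin L,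
      ∑ χ : Fin m → Fin L, (#{y | E χ b y} : ℝ) ≤ (L : ℝ) ^ m * (2 ^ m / 2) := by
    intro b
    have h := card_agree_le_one_le_half (fun j => (b, z j)) hP (M := M)
      (by rw [hq]; linarith) (by rw [hq]; exact hF) hspread
    rw [hq] at h
    have hsum : ∑ χ : Fin m → Fin L, #{y | E χ b y}
        = #{ω : Fin m → Fin L × Bool | #{i ∈ F | ∀ j ∈ P i, ω j = (b, z j)} ≤ 1} := by
      have hcard : ∀ χ : Fin m → Fin L, #{y | E χ b y} = ∑ y, if E χ b y then 1 else 0 :=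
        fun χ => card_filter _ _
      simp_rw [hcard]
      rw [card_filter, ← Fintype.sum_prod_type' (f := fun χ y => if E χ b y then 1 else 0)]
      refine (Fintype.sum_equiv (Equiv.arrowProdEquivProdArrow (Fin m) _ _) _ _ ?_).symm
      intro ω
      simp [hE, Prod.ext_iff, Equiv.arrowProdEquivProdArrow]
    have hsum' : ∑ χ : Fin m → Fin L, (#{y | E χ b y} : ℝ)
        = #{ω : Fin m → Fin L × Bool | #{i ∈ F | ∀ j ∈ P i, ω j = (b, z j)} ≤ 1} := by
      exact_mod_cast hsum
    rw [hsum']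
    refine le_trans (le_of_eq (by congr!)) (h.trans (le_of_eq ?_))
    rw [Fintype.card_fin, mul_pow]
    ring
  obtain ⟨χ, -, hχ⟩ : ∃ χ ∈ (univ : Finset (Fin m → Fin L)),
      ∑ b, (#{y | E χ b y} : ℝ) ≤ L * (2 ^ m / 2) := by
    refine exists_le_of_sum_le univ_nonempty ?_
    rw [sum_comm]
    refine (sum_le_sum fun b _ => hblock b).trans (le_of_eq ?_)
    simp
    ring
  have h2m : (0 : ℝ) < 2 ^ m := by positivity
  have hindep := density_forall_fiber χ (E χ) (by
    intro b y y' h hy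
    refine le_trans (le_of_eq ?_) hy
    congr 1
    refine filter_congr fun i _ => forall₂_congr fun j _ => and_congr_right fun hj => ?_
    rw [h j hj])
  rw [Fintype.card_fin] at hindep
  -- The arithmetic-geometric mean inequality, through `x ≤ exp (x - 1)`.
  have hprod : ∏ b, ((#{y | E χ b y} : ℝ) / 2 ^ m) ≤ (1 / 2) ^ L := by
    calc ∏ b, ((#{y | E χ b y} : ℝ) / 2 ^ m)
        ≤ ∏ b : Fin L, 1 / 2 * Real.exp (2 * ((#{y | E χ b y} : ℝ) / 2 ^ m) - 1) := by
          refine prod_le_prod (fun b _ => by positivity) fun b _ => ?_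
          linarith [Real.add_one_le_exp (2 * ((#{y | E χ b y} : ℝ) / 2 ^ m) - 1)]
      _ = (1 / 2) ^ L * Real.exp (2 * ((∑ b, (#{y | E χ b y} : ℝ)) / 2 ^ m) - L) := by
          rw [prod_mul_distrib, ← Real.exp_sum, sum_sub_distrib, ← mul_sum, ← sum_div]
          simp
      _ ≤ (1 / 2) ^ L * 1 := by
          gcongr
          rw [Real.exp_le_one_iff, sub_nonpos, mul_div_assoc', div_le_iff₀ h2m]
          linarith
      _ = (1 / 2) ^ L := mul_one _
  rw [← hindep, div_le_iff₀ h2m] at hprod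
  calc (#{y : Fin m → Bool | #{i ∈ F | ∀ j ∈ P i, y j = z j} ≤ 1} : ℝ)
      ≤ #{y | ∀ b, E χ b y} := by
        refine Nat.cast_le.2 (card_le_card fun y hy => ?_)
        simp only [mem_filter, mem_univ, true_and] at hy ⊢
        intro b
        refine le_trans (card_le_card fun i hi => ?_) hy
        simp only [mem_filter] at hi ⊢
        exact ⟨hi.1, fun j hj => (hi.2 j hj).2⟩
    _ ≤ (1 / 2) ^ L * 2 ^ m := le_trans (le_of_eq (by congr!)) hprod
    _ = 2 ^ m / 2 ^ L := by rw [one_div, inv_pow]; ring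

/-! ### The robust sunflower lemma for terms -/

theorem DNFTerm.eval_eq_true_iff {m : ℕ} {T : DNFTerm m} {y : Fin m → Bool} :
    T.eval y = true ↔ ∀ l ∈ T, y l.1 = l.2 := by
  simp [DNFTerm.eval]

theorem DNF.eval_eq_true_iff {m : ℕ} {φ : DNF m} {y : Fin m → Bool} :
    φ.eval y = true ↔ ∃ T ∈ φ, T.eval y = true := by
  simp [DNF.eval]

/-- An assignment satisfies a satisfiable term when it agrees with a satisfying assignment on the
variables of the term. -/
theorem DNFTerm.eval_of_agree {m : ℕ} {T : DNFTerm m} {y z : Fin m → Bool}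
    (hz : T.eval z = true) (h : ∀ j ∈ T.image Prod.fst, y j = z j) : T.eval y = true := by
  rw [DNFTerm.eval_eq_true_iff] at hz ⊢
  intro l hl
  rw [h l.1 (Finset.mem_image_of_mem _ hl), hz l hl]

open Finset in
theorem DNFTerm.two_pow_le_card_eval_mul {m d : ℕ} {T : DNFTerm m} (hd : #T ≤ d)
    (hT : ∃ z, T.eval z = true) : 2 ^ m ≤ #{y | T.eval y = true} * 2 ^ d := by
  obtain ⟨z, hz⟩ := hT
  have h := card_filter_agree_mul_pow (T.image Prod.fst) z
  rw [Fintype.card_bool, Fintype.card_fin] at h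
  rw [← h]
  refine Nat.mul_le_mul (card_le_card fun y hy => ?_)
    (Nat.pow_le_pow_right two_pos (card_image_le.trans hd))
  simp only [mem_filter, mem_univ, true_and] at hy ⊢
  exact eval_of_agree hz hy

open Finset in
/-- By averaging over all assignments `z`, each term being satisfied by at least a `2 ^ (-d)`
fraction of them. -/
theorem exists_assignment_eval_many {m d : ℕ} {I : Type*} {D : Finset I} {T : I → DNFTerm m}
    (hsat : ∀ i ∈ D, ∃ z, (T i).eval z = true) (hd : ∀ i ∈ D, #(T i) ≤ d) :
    ∃ z, #D ≤ #{i ∈ D | (T i).eval z = true} * 2 ^ d := by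
  obtain ⟨z, -, hz⟩ : ∃ z ∈ (univ : Finset (Fin m → Bool)),
      #D ≤ #{i ∈ D | (T i).eval z = true} * 2 ^ d := by
    refine exists_le_of_sum_le univ_nonempty ?_
    rw [← sum_mul]
    simp_rw [card_filter]
    rw [sum_comm, sum_mul, sum_const, smul_eq_mul, mul_comm]
    simp only [Finset.card_univ, Fintype.card_fun, Fintype.card_bool, Fintype.card_fin]
    rw [← smul_eq_mul, ← sum_const]
    refine sum_le_sum fun i hi => ?_
    rw [← card_filter]
    exact DNFTerm.two_pow_le_card_eval_mul (hd i hi) (hsat i hi)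
  exact ⟨z, hz⟩

open Finset in
/-- A robust sunflower lemma. Among many satisfiable terms of small width, the ones containing a
suitable subterm `K` form a sunflower with kernel `K`: when `K` is satisfied, two of the terms are
satisfied except with exponentially small probability. -/
theorem exists_kernel {m d L : ℕ} {I : Type*} (hL : 1 ≤ L) {D : Finset I}
    {T : I → DNFTerm m} (hsat : ∀ i ∈ D, ∃ z, (T i).eval z = true)
    (hd : ∀ i ∈ D, #(T i) ≤ d) (hD : 2 * (128 * L ^ 2 * (d + 1)) ^ d ≤ #D) :
    ∃ i ∈ D, ∃ K : DNFTerm m, K ⊆ T i ∧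
      (#{y | K.eval y = true ∧ #{i ∈ D | (T i).eval y = true} ≤ 1} : ℝ) ≤ 2 ^ m / 2 ^ L := by
  classical
  obtain ⟨z, hz⟩ := exists_assignment_eval_many hsat hd
  set Dz : Finset I := {i ∈ D | (T i).eval z = true} with hDz
  set V : I → Finset (Fin m) := fun i => (T i).image Prod.fst with hV
  have hVd : ∀ i ∈ D, #(V i) ≤ d := fun i hi => card_image_le.trans (hd i hi)
  set M : ℕ := 32 * L * (d + 1) with hMdef
  have hM1 : 1 ≤ M := by
    rw [hMdef]
    exact Nat.succ_le_of_lt (by positivity)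
  -- Maximality of `K` for this weight makes the petals `V i \ K` a spread family.
  obtain ⟨K, -, hK⟩ := exists_max_image (univ : Finset (Finset (Fin m)))
    (fun K => #{i ∈ Dz | K ⊆ V i} * M ^ #K) univ_nonempty
  set F : Finset I := {i ∈ Dz | K ⊆ V i} with hFdef
  have hFDz : #Dz ≤ #F * M ^ #K := by
    simpa using hK ∅ (mem_univ _)
  have hDpos : 0 < #D := lt_of_lt_of_le (by positivity) hD
  have hFpos : 0 < #F := by
    by_contra h
    have h0 : #F = 0 := by omega
    rw [h0, zero_mul] at hFDz
    have : #Dz = 0 := by omega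
    rw [this, zero_mul] at hz
    omega
  obtain ⟨i₀, hi₀⟩ := card_pos.1 hFpos
  have hmemF : ∀ i ∈ F, i ∈ D ∧ (T i).eval z = true ∧ K ⊆ V i := by
    intro i hi
    have h1 := mem_filter.1 hi
    have h2 := mem_filter.1 h1.1
    exact ⟨h2.1, h2.2, h1.2⟩
  have hKd : #K ≤ d := (card_le_card (hmemF i₀ hi₀).2.2).trans (hVd i₀ (hmemF i₀ hi₀).1)
  have hFlarge : 2 * (2 * L) ^ d ≤ #F := by
    have h1 : #D ≤ #F * M ^ d * 2 ^ d :=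
      hz.trans (Nat.mul_le_mul_right _ (hFDz.trans
        (Nat.mul_le_mul_left _ (Nat.pow_le_pow_right hM1 hKd))))
    have h2 : 2 * (128 * L ^ 2 * (d + 1)) ^ d = 2 * (2 * L) ^ d * (M ^ d * 2 ^ d) := by
      rw [hMdef, mul_assoc 2, ← mul_pow, ← mul_pow]
      ring
    have h3 : 0 < M ^ d * 2 ^ d := by positivity
    refine Nat.le_of_mul_le_mul_right ?_ h3
    rw [← h2, ← mul_assoc]
    exact hD.trans h1
  have hspread : ∀ J : Finset (Fin m), #{i ∈ F | J ⊆ V i \ K} * M ^ #J ≤ #F := by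
    intro J
    by_cases hJ : ∃ i ∈ F, J ⊆ V i \ K
    · obtain ⟨i, hi, hJi⟩ := hJ
      have hdisj : Disjoint J K := disjoint_of_subset_left hJi sdiff_disjoint
      have h1 := hK (J ∪ K) (mem_univ _)
      rw [card_union_of_disjoint hdisj, pow_add, ← mul_assoc] at h1
      have h2 := Nat.le_of_mul_le_mul_right h1 (by positivity)
      refine le_trans (Nat.mul_le_mul_right _ (card_le_card fun i' hi' => ?_)) h2
      have h3 := mem_filter.1 hi'
      have h4 := mem_filter.1 h3.1
      exact mem_filter.2 ⟨h4.1, union_subset (h3.2.trans sdiff_subset) h4.2⟩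
    · push Not at hJ
      rw [filter_false_of_mem hJ]
      simp
  have hbound := card_agree_le_one_le_two_pow (M := M) (d := d) hL z (F := F)
    (P := fun i => V i \ K)
    (fun i hi => (card_le_card sdiff_subset).trans (hVd i (hmemF i hi).1))
    (by rw [hMdef]; push_cast; exact le_rfl) (by exact_mod_cast hFlarge)
    (fun J => by exact_mod_cast hspread J)
  refine ⟨i₀, (hmemF i₀ hi₀).1, K.image fun j => (j, z j), ?_, ?_⟩
  · intro l hl
    obtain ⟨j, hj, rfl⟩ := mem_image.1 hl
    obtain ⟨l', hl', rfl⟩ := mem_image.1 ((hmemF i₀ hi₀).2.2 hj)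
    rw [DNFTerm.eval_eq_true_iff.1 (hmemF i₀ hi₀).2.1 l' hl']
    exact hl'
  · refine le_trans (Nat.cast_le.2 (card_le_card fun y hy => ?_)) hbound
    simp only [mem_filter, mem_univ, true_and] at hy ⊢
    obtain ⟨hyK, hy1⟩ := hy
    rw [DNFTerm.eval_eq_true_iff] at hyK
    refine le_trans (card_le_card fun i hi => ?_) hy1
    obtain ⟨hiF, hiP⟩ := mem_filter.1 hi
    obtain ⟨hiD, hiz, -⟩ := hmemF i hiF
    refine mem_filter.2 ⟨hiD, DNFTerm.eval_of_agree hiz fun j hj => ?_⟩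
    by_cases hjK : j ∈ K
    · exact hyK (j, z j) (mem_image_of_mem _ hjK)
    · exact hiP j (mem_sdiff.2 ⟨hj, hjK⟩)

/-! ### Weight one outputs of DNFs -/

open Finset in
/-- Outside few output bits `S`, every satisfiable term contains a kernel, and a satisfied kernel
makes weight at most one unlikely. -/
theorem exists_small_card_and_card_eval_le {m n d s L : ℕ} (hL : 1 ≤ L)
    (f : (Fin m → Bool) → (Fin n → Bool)) (φ : Fin n → DNF m)
    (hs : ∀ i, (φ i).size ≤ s) (hd : ∀ i, (φ i).width ≤ d)
    (hf : ∀ i y, f y i = (φ i).eval y) :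
    ∃ S : Finset (Fin n), #S < 2 * (128 * L ^ 2 * (d + 1)) ^ d ∧
      (#{y | hammingWeight (f y) ≤ 1 ∧ ∃ i ∉ S, f y i = true} : ℝ)
        ≤ n * s * (2 ^ m / 2 ^ L) := by
  classical
  -- A kernel is a term `K` for which `bad K` is small.
  set bad : DNFTerm m → Finset (Fin m → Bool) := fun K =>
    {y | K.eval y = true ∧ hammingWeight (f y) ≤ 1} with hbad
  set S : Finset (Fin n) := {i | ∃ T ∈ φ i, (∃ z, T.eval z = true) ∧
    ∀ K ⊆ T, ¬ (#(bad K) : ℝ) ≤ 2 ^ m / 2 ^ L} with hS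
  refine ⟨S, ?_, ?_⟩
  · by_contra! hlarge
    have hT : ∀ i, ∃ T : DNFTerm m, i ∈ S → T ∈ φ i ∧ (∃ z, T.eval z = true) ∧
        ∀ K ⊆ T, ¬ (#(bad K) : ℝ) ≤ 2 ^ m / 2 ^ L := by
      intro i
      by_cases hi : i ∈ S
      · obtain ⟨T, h1, h2⟩ := (mem_filter.1 hi).2
        exact ⟨T, fun _ => ⟨h1, h2⟩⟩
      · exact ⟨∅, fun h => absurd h hi⟩
    choose T hT using hT
    obtain ⟨i, hi, K, hKT, hK⟩ := exists_kernel hL (D := S) (T := T) (fun i hi => (hT i hi).2.1)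
      (fun i hi => (le_sup (f := Finset.card) (hT i hi).1).trans (hd i)) hlarge
    refine (hT i hi).2.2 K hKT (le_trans (Nat.cast_le.2 (card_le_card fun y hy => ?_)) hK)
    simp only [hbad, mem_filter, mem_univ, true_and] at hy ⊢
    refine ⟨hy.1, le_trans (card_le_card fun i hi => ?_) hy.2⟩
    obtain ⟨hiS, hiT⟩ := mem_filter.1 hi
    rw [mem_filter, hf, DNF.eval_eq_true_iff]
    exact ⟨mem_univ _, T i, (hT i hiS).1, hiT⟩
  · have hK : ∀ i T, ∃ K : DNFTerm m, i ∉ S → T ∈ φ i → (∃ z, T.eval z = true) →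
        K ⊆ T ∧ (#(bad K) : ℝ) ≤ 2 ^ m / 2 ^ L := by
      intro i T
      by_cases h : i ∉ S ∧ T ∈ φ i ∧ ∃ z, T.eval z = true
      · obtain ⟨hi, hT, hz⟩ := h
        have : ∃ K ⊆ T, (#(bad K) : ℝ) ≤ 2 ^ m / 2 ^ L := by
          by_contra! hno
          exact hi (mem_filter.2 ⟨mem_univ _, T, hT, hz, fun K hK => not_le.2 (hno K hK)⟩)
        obtain ⟨K, h⟩ := this
        exact ⟨K, fun _ _ _ => h⟩
      · exact ⟨∅, fun h1 h2 h3 => absurd ⟨h1, h2, h3⟩ h⟩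
    choose K hK using hK
    have hε : (0 : ℝ) ≤ 2 ^ m / 2 ^ L := by positivity
    set Q : Fin n → Finset (DNFTerm m) := fun i =>
      {T ∈ φ i | i ∉ S ∧ ∃ z, T.eval z = true} with hQ
    have hsub : ({y | hammingWeight (f y) ≤ 1 ∧ ∃ i ∉ S, f y i = true} : Finset _)
        ⊆ univ.biUnion fun i => (Q i).biUnion fun T => bad (K i T) := by
      intro y hy
      simp only [mem_filter, mem_univ, true_and] at hy
      obtain ⟨hy1, i, hi, hyi⟩ := hy
      rw [hf, DNF.eval_eq_true_iff] at hyi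
      obtain ⟨T, hT, hTy⟩ := hyi
      refine mem_biUnion.2 ⟨i, mem_univ _, mem_biUnion.2
        ⟨T, mem_filter.2 ⟨hT, hi, y, hTy⟩, mem_filter.2 ⟨mem_univ _, ?_, hy1⟩⟩⟩
      rw [DNFTerm.eval_eq_true_iff] at hTy ⊢
      exact fun l hl => hTy l ((hK i T hi hT ⟨y, DNFTerm.eval_eq_true_iff.2 hTy⟩).1 hl)
    calc (#{y | hammingWeight (f y) ≤ 1 ∧ ∃ i ∉ S, f y i = true} : ℝ)
        ≤ ∑ i, ∑ T ∈ Q i, (#(bad (K i T)) : ℝ) := by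
          refine (Nat.cast_le.2 ((card_le_card hsub).trans (card_biUnion_le.trans
            (sum_le_sum fun i _ => card_biUnion_le)))).trans (le_of_eq ?_)
          push_cast
          rfl
      _ ≤ ∑ i, ∑ T ∈ Q i, ((2 : ℝ) ^ m / 2 ^ L) := by
          refine sum_le_sum fun i _ => sum_le_sum fun T hT => ?_
          obtain ⟨h1, h2, h3⟩ := mem_filter.1 hT
          exact (hK i T h2 h1 h3).2
      _ ≤ ∑ i : Fin n, s * ((2 : ℝ) ^ m / 2 ^ L) := by
          refine sum_le_sum fun i _ => ?_
          rw [sum_const, nsmul_eq_mul]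
          gcongr
          exact (card_le_card (filter_subset _ _)).trans (hs i)
      _ = n * s * (2 ^ m / 2 ^ L) := by
          rw [sum_const, nsmul_eq_mul, Finset.card_univ, Fintype.card_fin, mul_assoc]

/-! ### Statistical distance to the uniform weight one string -/

theorem abs_sub_le_statDist {α : Type*} [Finite α] (P Q : PMF α) (A : Set α) :
    |(P.toOuterMeasure A).toReal - (Q.toOuterMeasure A).toReal| ≤ statDist P Q :=
  le_ciSup (f := fun A : Set α => |(P.toOuterMeasure A).toReal - (Q.toOuterMeasure A).toReal|)
    (Set.finite_range _).bddAbove A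

open Finset in
theorem toReal_sourceDist {m n : ℕ} (f : (Fin m → Bool) → (Fin n → Bool))
    (A : Set (Fin n → Bool)) [DecidablePred (· ∈ A)] :
    ((sourceDist f).toOuterMeasure A).toReal = (#{y | f y ∈ A} : ℝ) / 2 ^ m := by
  classical
  rw [sourceDist, PMF.toOuterMeasure_map_apply, PMF.toOuterMeasure_uniformOfFintype_apply,
    ENNReal.toReal_div, ENNReal.toReal_natCast, ENNReal.toReal_natCast, Fintype.card_subtype,
    Fintype.card_fun, Fintype.card_bool, Fintype.card_fin]
  push_cast
  congr!

open Finset in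
theorem hammingWeight_eq_one_iff {n : ℕ} {x : Fin n → Bool} :
    hammingWeight x = 1 ↔ ∃ i, x = fun j => decide (j = i) := by
  rw [hammingWeight, card_eq_one]
  refine exists_congr fun i => ?_
  simp only [Finset.ext_iff, mem_filter, mem_univ, true_and, mem_singleton, funext_iff]
  refine forall_congr' fun j => ?_
  by_cases h : j = i <;> simp [h]

open Finset in
theorem toReal_uniformSlice_one {n : ℕ} (hn : 1 ≤ n) (A : Set (Fin n → Bool))
    [DecidablePred (· ∈ A)] :
    ((uniformSlice n 1 hn).toOuterMeasure A).toReal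
      = (#{i : Fin n | (fun j => decide (j = i)) ∈ A} : ℝ) / n := by
  classical
  set e : Fin n ↪ (Fin n → Bool) := ⟨fun i j => decide (j = i), fun i i' h => by
    simpa using congrFun h i⟩ with he
  have hslice : boolSlice n 1 = univ.map e := by
    ext x
    simp [boolSlice, hammingWeight_eq_one_iff, he, eq_comm]
  rw [uniformSlice, PMF.toOuterMeasure_uniformOfFinset_apply, ENNReal.toReal_div,
    ENNReal.toReal_natCast, ENNReal.toReal_natCast]
  simp only [hslice, filter_map, card_map, Finset.card_univ, Fintype.card_fin]
  congr!

open Finset in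
/-- The distinguishing event is that the weight is at most one and some bit outside the small set
`S` is `1`. -/
theorem one_sub_le_statDist_uniformSlice {m n d s L : ℕ} (hn : 1 ≤ n) (hL : 1 ≤ L)
    (f : (Fin m → Bool) → (Fin n → Bool))
    (hf : ∀ i : Fin n, ∃ φ : DNF m, DNF.size φ ≤ s ∧ DNF.width φ ≤ d ∧
      ∀ y : Fin m → Bool, f y i = DNF.eval φ y) :
    1 - 2 * (128 * L ^ 2 * (d + 1)) ^ d / n - n * s / 2 ^ L
      ≤ statDist (sourceDist f) (uniformSlice n 1 hn) := by
  classical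
  choose φ hs hd hφ using hf
  obtain ⟨S, hS, hA⟩ := exists_small_card_and_card_eval_le hL f φ hs hd hφ
  have hn0 : (0 : ℝ) < n := by exact_mod_cast hn
  set A : Set (Fin n → Bool) := {x | hammingWeight x ≤ 1 ∧ ∃ i ∉ S, x i = true} with hAdef
  refine le_trans ?_ (abs_sub_le_statDist _ _ A)
  rw [abs_sub_comm]
  refine le_trans ?_ (le_abs_self _)
  rw [toReal_sourceDist, toReal_uniformSlice_one]
  have h1 : (n : ℝ) - #S ≤ #{i : Fin n | (fun j => decide (j = i)) ∈ A} := by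
    have hsub : Sᶜ ⊆ ({i : Fin n | (fun j => decide (j = i)) ∈ A} : Finset (Fin n)) := by
      intro i hi
      refine mem_filter.2 ⟨mem_univ _, (hammingWeight_eq_one_iff.2 ⟨i, rfl⟩).le, i, ?_⟩
      simpa using hi
    have h2 := card_le_card hsub
    rw [card_compl, Fintype.card_fin, Nat.sub_le_iff_le_add] at h2
    have : (n : ℝ) ≤ #{i : Fin n | (fun j => decide (j = i)) ∈ A} + #S := by exact_mod_cast h2
    linarith
  have h2 : (#{y | f y ∈ A} : ℝ) / 2 ^ m ≤ n * s / 2 ^ L := by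
    rw [div_le_iff₀ (by positivity)]
    refine le_trans (le_of_eq ?_) (hA.trans (le_of_eq (by ring)))
    congr!
  have h3 : (#S : ℝ) ≤ 2 * (128 * L ^ 2 * (d + 1)) ^ d := by exact_mod_cast hS.le
  have h4 : 1 - 2 * (128 * (L : ℝ) ^ 2 * (d + 1)) ^ d / n
      ≤ (#{i : Fin n | (fun j => decide (j = i)) ∈ A} : ℝ) / n := by
    rw [le_div_iff₀ hn0, sub_mul, div_mul_cancel₀ _ hn0.ne']
    linarith
  linarith

/-! ### Choice of parameters -/

/-- With `L` about `2 (|κ| + 4) log n`, both error terms of `one_sub_le_statDist_uniformSlice` are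
small: the first is at most `2 n ^ (-3 / 4)`, the second at most `1 / n`. -/
theorem exists_block_number {κ : ℝ} {n d s : ℕ} (hn : 1 ≤ n)
    (h16 : 16 ≤ Real.log n) (hloglog : 1 ≤ Real.log (Real.log n))
    (hA : 128 * (2 * (|κ| + 4) + 1) ^ 2 ≤ Real.log n) (hκ : |κ| + 1 ≤ n)
    (hd : (d : ℝ) ≤ 1 / 16 * Real.log n / Real.log (Real.log n))
    (hs : (s : ℝ) ≤ κ * (n : ℝ) ^ κ) :
    ∃ L : ℕ, 1 ≤ L ∧
      2 * (128 * (L : ℝ) ^ 2 * (d + 1)) ^ d / n + n * s / 2 ^ L ≤ (n : ℝ) ^ (-(1 / 2) : ℝ) := by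
  set ℓ := Real.log n with hℓ
  have hn0 : (0 : ℝ) < n := by exact_mod_cast hn
  have hn1 : (1 : ℝ) ≤ n := by exact_mod_cast hn
  have hexp : Real.exp ℓ = n := Real.exp_log hn0
  have hℓ0 : 0 < ℓ := by linarith
  set a := 2 * (|κ| + 4) with ha
  have ha8 : 8 ≤ a := by linarith [abs_nonneg κ]
  have hdlog : d * Real.log ℓ ≤ ℓ / 16 := by
    rw [le_div_iff₀ (by linarith)] at hd
    linarith
  have hdℓ : (d : ℝ) + 1 ≤ ℓ := by
    have : (d : ℝ) ≤ d * Real.log ℓ := le_mul_of_one_le_right (Nat.cast_nonneg d) hloglog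
    linarith
  refine ⟨⌈a * ℓ⌉₊, Nat.one_le_ceil_iff.2 (by positivity), ?_⟩
  set L : ℝ := (⌈a * ℓ⌉₊ : ℝ) with hLdef
  have hL1 : a * ℓ ≤ L := Nat.le_ceil _
  have hL2 : L ≤ (a + 1) * ℓ := by
    have := (Nat.ceil_lt_add_one (a := a * ℓ) (by positivity)).le
    linarith
  have hL0 : 0 ≤ L := Nat.cast_nonneg _
  have hbase : 128 * L ^ 2 * (d + 1) ≤ ℓ ^ 4 := by
    calc 128 * L ^ 2 * (d + 1) ≤ 128 * ((a + 1) * ℓ) ^ 2 * ℓ := by gcongr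
      _ = (128 * (a + 1) ^ 2) * ℓ ^ 3 := by ring
      _ ≤ ℓ * ℓ ^ 3 := by gcongr
      _ = ℓ ^ 4 := by ring
  have hfirst : (128 * L ^ 2 * (d + 1)) ^ d ≤ Real.exp (ℓ / 4) := by
    calc (128 * L ^ 2 * (d + 1)) ^ d ≤ (ℓ ^ 4) ^ d := by gcongr
      _ = Real.exp (4 * (d * Real.log ℓ)) := by
          rw [← pow_mul, ← Real.exp_log (pow_pos hℓ0 _), Real.log_pow]
          push_cast
          ring_nf
      _ ≤ Real.exp (ℓ / 4) := by
          gcongr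
          linarith
  have hsecond : n * s / (2 : ℝ) ^ ⌈a * ℓ⌉₊ ≤ Real.exp (-ℓ) := by
    have hs' : (s : ℝ) ≤ Real.exp (ℓ * (|κ| + 1)) := by
      calc (s : ℝ) ≤ κ * (n : ℝ) ^ κ := hs
        _ ≤ (|κ| + 1) * (n : ℝ) ^ |κ| := by
            gcongr
            · linarith [le_abs_self κ]
            · exact le_abs_self κ
        _ ≤ n * (n : ℝ) ^ |κ| := by gcongr
        _ = Real.exp (ℓ * (|κ| + 1)) := by
            rw [Real.rpow_def_of_pos hn0, ← hℓ]
            nth_rw 1 [← hexp]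
            rw [← Real.exp_add]
            ring_nf
    have h2 : Real.exp (1 / 2) ≤ 2 := by
      have h4 : Real.exp (1 / 2) ^ 2 ≤ 4 := by
        rw [← Real.exp_nat_mul]
        norm_num
        linarith [Real.exp_one_lt_d9]
      nlinarith [Real.exp_pos (1 / 2)]
    have h2L : Real.exp (ℓ * (|κ| + 4)) ≤ (2 : ℝ) ^ ⌈a * ℓ⌉₊ := by
      calc Real.exp (ℓ * (|κ| + 4)) ≤ Real.exp (L * (1 / 2)) :=
            Real.exp_le_exp.2 (by rw [ha] at hL1; linarith)
        _ = Real.exp (1 / 2) ^ ⌈a * ℓ⌉₊ := by rw [← Real.exp_nat_mul]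
        _ ≤ 2 ^ ⌈a * ℓ⌉₊ := by gcongr
    rw [div_le_iff₀ (by positivity)]
    calc n * (s : ℝ) ≤ Real.exp ℓ * Real.exp (ℓ * (|κ| + 1)) := by rw [hexp]; gcongr
      _ = Real.exp (ℓ * (|κ| + 2)) := by rw [← Real.exp_add]; ring_nf
      _ ≤ Real.exp (-ℓ + ℓ * (|κ| + 4)) := by
          gcongr
          linarith
      _ ≤ Real.exp (-ℓ) * (2 : ℝ) ^ ⌈a * ℓ⌉₊ := by
          rw [Real.exp_add]
          gcongr
  have hthree : (3 : ℝ) ≤ Real.exp (ℓ / 4) := by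
    linarith [Real.add_one_le_exp (ℓ / 4)]
  calc 2 * (128 * L ^ 2 * (d + 1)) ^ d / n + n * s / 2 ^ ⌈a * ℓ⌉₊
      ≤ 2 * Real.exp (ℓ / 4) / n + Real.exp (-ℓ) := by gcongr
    _ = 2 * Real.exp (-(3 * ℓ / 4)) + Real.exp (-ℓ) := by
        nth_rw 1 [← hexp]
        rw [mul_div_assoc, ← Real.exp_sub]
        ring_nf
    _ ≤ 2 * Real.exp (-(3 * ℓ / 4)) + Real.exp (-(3 * ℓ / 4)) := by
        gcongr
        linarith
    _ = 3 * Real.exp (-(3 * ℓ / 4)) := by ring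
    _ ≤ Real.exp (ℓ / 4) * Real.exp (-(3 * ℓ / 4)) := by gcongr
    _ = (n : ℝ) ^ (-(1 / 2) : ℝ) := by
        rw [← Real.exp_add, Real.rpow_def_of_pos hn0]
        ring_nf
        rfl

theorem mainTheorem4 (κ : ℝ) :
    ∃ τ : ℝ, 0 < τ ∧ ∃ c : ℝ, 0 < c ∧ ∃ n₀ : ℕ,
      ∀ (n : ℕ) (hn : 1 ≤ n), n₀ ≤ n →
      ∀ d s : ℕ, (d : ℝ) ≤ τ * Real.log n / Real.log (Real.log n) →
        (s : ℝ) ≤ κ * (n : ℝ) ^ κ →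
      ∀ (m : ℕ) (f : (Fin m → Bool) → (Fin n → Bool)),
        (∀ i : Fin n, ∃ φ : DNF m, DNF.size φ ≤ s ∧ DNF.width φ ≤ d ∧
          ∀ y : Fin m → Bool, f y i = DNF.eval φ y) →
        1 - (n : ℝ) ^ (-c) ≤ statDist (sourceDist f) (uniformSlice n 1 hn) := by
  have hlog : Filter.Tendsto (fun n : ℕ => Real.log n) Filter.atTop Filter.atTop :=
    Real.tendsto_log_atTop.comp tendsto_natCast_atTop_atTop
  obtain ⟨n₀, hn₀⟩ := Filter.eventually_atTop.1
    ((hlog.eventually_ge_atTop 16).and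
      (((Real.tendsto_log_atTop.comp hlog).eventually_ge_atTop 1).and
        ((hlog.eventually_ge_atTop (128 * (2 * (|κ| + 4) + 1) ^ 2)).and
          (tendsto_natCast_atTop_atTop.eventually_ge_atTop (|κ| + 1)))))
  refine ⟨1 / 16, by norm_num, 1 / 2, by norm_num, n₀, ?_⟩
  intro n hn hnn₀ d s hd hs m f hf
  obtain ⟨h16, hloglog, hA, hκ⟩ := hn₀ n hnn₀
  obtain ⟨L, hL, hbound⟩ := exists_block_number hn h16 hloglog hA hκ hd hs
  linarith [one_sub_le_statDist_uniformSlice hn hL f hf]
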